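/- Conventions. A simplicial complex $K$ on a finite set is a collection of subsets (faces) closed under inclusion and containing $\emptyset$; an $i$-face has $i+1$ elements, $S_i(K)$ is the set of $i$-faces, and $\dim K\ge -1$ is the maximal dimension of a face. $C^i(K,\mathbb R)$, $i\in\mathbb Z$, is the space of real $i$-cochains (so $C^{-1}\cong\mathbb R$), with simplicial coboundary maps $\delta_i:C^i\to C^{i+1}$ of the augmented complex. A positive weight function $w$ on the faces gives the scalar products $(f,g)=\sum_{F\in S_i(K)}w(F)f([F])g([F])$ on $C^i$, the adjoints $\delta_i^*$, and the operators $\mathcal L^{up}_i=\delta_i^*\delta_i$ and $\mathcal L^{down}_i=\delta_{i-1}\delta_{i-1}^*$. The weight function is called normalizing, and the operators (weighted) normalized, written $\Delta^{up}_i,\Delta^{down}_i$, if $w(F)=\sum_{\bar F\in S_{\dim F+1}(K),\,\bar F\supset F}w(\bar F)$ for every face $F$ that is not maximal under inclusion. $\mathbf s(A)$ is the multiset of eigenvalues of $A$, and $s\stackrel{\circ}{=}t$ means that the multisets $s,t$ differ at most in the multiplicity of $0$. For a multiset $s$ with at most $N$ nonzero elements, $[s]_N$ denotes the multiset with exactly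 $N$ elements such that $[s]_N\stackrel{\circ}{=}s$. The join $K_1*K_2$ has the faces $F_1*F_2$ (disjoint union of $F_1\in K_1$ and $F_2\in K_2$; the vertices of $K_1$ come before those of $K_2$). **Corollary 6.7.** Let $K_1,K_2$ be simplicial complexes of dimensions $d_1,d_2$ with normalizing weight functions $w_1,w_2$, and let $\Delta(K_1*K_2)$ denote the Laplace operators of $K_1*K_2$ for the product weight function $w(F_1*F_2)=w_1(F_1)\,w_2(F_2)$. Then, as multisets, $$\mathbf s\big(\Delta^{down}_{d_1+d_2+1}(K_1*K_2)\big)\stackrel{\circ}{=}\{\lambda+\mu \mid \lambda\in \mathbf s(\Delta^{down}_{d_1}(K_1)),\ \mu\in \mathbf s(\Delta^{down}_{d_2}(K_2))\},$$ and, in terms of the up operators, $$\mathbf s\big(\Delta^{up}_{d_1+d_2}(K_1*K_2)\big)\stackrel{\circ}{=}\{\lambda+\mu \mid \lambda\in [\mathbf s(\Delta^{up}_{d_1-1}(K_1))]_{|S_{d_1}(K_1)|},\ \mu\in [\mathbf s(\Delta^{up}_{d_2-1}(K_2))]_{|S_{d_2}(K_2)|}\}.$$ In particular, let $K$ be a complex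 of dimension $d$ with a normalizing weight function. If $v*K$ is the cone over $K$, with the product of that weight function and any normalizing weight function on the one-vertex complex $v$, then $$\mathbf s(\Delta^{down}_{d+1}(v*K))\stackrel{\circ}{=}\{1+\mu\mid\mu\in\mathbf s(\Delta^{down}_d(K))\},\qquad \mathbf s(\Delta^{up}_{d}(v*K))\stackrel{\circ}{=}\{1+\mu\mid\mu\in[\mathbf s(\Delta^{up}_{d-1}(K))]_{|S_d(K)|}\}.$$ -/

import Mathlib

noncomputable section

/-- A (finite) abstract simplicial complex: a collection of subsets of a finite set `V`, closed
under inclusion. As usual for augmented cochain complexes the empty set is a face (of dimension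
`-1`); Mathlib's abstract simplicial complexes exclude the empty face. It is not required that
every element of `V` is a vertex. -/
structure FaceComplex (V : Type) [LinearOrder V] [Fintype V] where
  faces : Finset (Finset V)
  empty_mem : ∅ ∈ faces
  down_closed : ∀ {F G : Finset V}, G ∈ faces → F ⊆ G → F ∈ faces

namespace FaceComplex

variable {V : Type} [LinearOrder V] [Fintype V]

/-- The dimension of the complex: the maximal dimension `|F| - 1` of a face `F`. -/
def dim (K : FaceComplex V) : ℤ := ((K.faces.sup Finset.card : ℕ) : ℤ) - 1

/-- `S_i(K)`: the `i`-faces, i.e. the faces with `i + 1` elements (`i` is any integer; the set is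
empty for `i < -1`). -/
def iFaces (K : FaceComplex V) (i : ℤ) : Finset (Finset V) :=
  K.faces.filter fun F => (F.card : ℤ) = i + 1

/-- The cochain space `C^i(K, ℝ)`. Every face is oriented by the increasing order of its vertices;
the value of a cochain on a face is its value on the face with this orientation. -/
abbrev Cochain (K : FaceComplex V) (i : ℤ) : Type := ↥(K.iFaces i) → ℝ

/-- `sgn([F], ∂[G])`: it is `(-1)^k` if `F` arises from `G = {v_0 < v_1 < ...}` by omitting `v_k`,
and `0` if `F` is not a codimension one face of `G`. -/
def bdrySign (F G : Finset V) : ℝ :=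
  ∑ v ∈ G, if G.erase v = F then (-1 : ℝ) ^ (G.filter (· < v)).card else 0

/-- The simplicial coboundary map `δ_i : C^i → C^j`, where `j = i + 1`
(the two degrees are separate arguments so that `δ_{i-1}` takes values in `C^i` itself). -/
def coboundary (K : FaceComplex V) (i j : ℤ) : K.Cochain i →ₗ[ℝ] K.Cochain j where
  toFun f G := ∑ F : K.iFaces i, bdrySign F.1 G.1 * f F
  map_add' f g := by
    ext G
    simp [mul_add, Finset.sum_add_distrib]
  map_smul' c f := by
    ext G
    simp only [Pi.smul_apply, smul_eq_mul, RingHom.id_apply, Finset.mul_sum]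
    exact Finset.sum_congr rfl fun F _ => by ring

/-- A codimension one subset of a `j`-face is an `i`-face, if `j = i + 1`. -/
theorem erase_mem_iFaces (K : FaceComplex V) {i j : ℤ} (hij : j = i + 1)
    (G : K.iFaces j) (v : V) (hv : v ∈ G.1) : G.1.erase v ∈ K.iFaces i := by
  have hG := Finset.mem_filter.1 G.2
  refine Finset.mem_filter.2 ⟨K.down_closed hG.1 (Finset.erase_subset _ _), ?_⟩
  have h := Finset.card_erase_add_one hv
  have h' := hG.2
  omega

/-- The usual formula `(δ f)([v_0, ..., v_{i+1}]) = ∑ k, (-1)^k f([v_0, ..., v̂_k, ..., v_{i+1}])`. -/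
theorem coboundary_apply (K : FaceComplex V) {i j : ℤ} (hij : j = i + 1)
    (f : K.Cochain i) (G : K.iFaces j) :
    K.coboundary i j f G =
      ∑ v : G.1, (-1 : ℝ) ^ (G.1.filter (· < v.1)).card *
        f ⟨G.1.erase v.1, K.erase_mem_iFaces hij G v.1 v.2⟩ := by
  have key : ∀ F : K.iFaces i, bdrySign F.1 G.1 * f F =
      ∑ v : G.1, if (⟨G.1.erase v.1, K.erase_mem_iFaces hij G v.1 v.2⟩ : K.iFaces i) = F then
        (-1 : ℝ) ^ (G.1.filter (· < v.1)).card * f F else 0 := by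
    intro F
    rw [bdrySign, Finset.sum_mul, ← Finset.sum_coe_sort]
    refine Finset.sum_congr rfl fun v _ => ?_
    simp only [Subtype.ext_iff, ite_mul, zero_mul]
  change ∑ F : K.iFaces i, bdrySign F.1 G.1 * f F = _
  rw [Finset.sum_congr rfl fun F _ => key F, Finset.sum_comm]
  refine Finset.sum_congr rfl fun v _ => ?_
  rw [Finset.sum_ite_eq]
  simp

/-- The scalar product on `C^i(K, ℝ)` given by a weight function `w` on the faces. -/
def scalar (K : FaceComplex V) (w : Finset V → ℝ) (i : ℤ) (f g : K.Cochain i) : ℝ :=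
  ∑ F : K.iFaces i, w F.1 * f F * g F

/-- The adjoint `δ_i^* : C^j → C^i` (`j = i + 1`) of the coboundary map with respect to the scalar
products given by `w`; see `scalar_coboundary`. -/
def coboundaryAdj (K : FaceComplex V) (w : Finset V → ℝ) (i j : ℤ) :
    K.Cochain j →ₗ[ℝ] K.Cochain i where
  toFun g F := ∑ G : K.iFaces j, w G.1 / w F.1 * bdrySign F.1 G.1 * g G
  map_add' f g := by
    ext G
    simp [mul_add, Finset.sum_add_distrib]
  map_smul' c f := by
    ext G
    simp only [Pi.smul_apply, smul_eq_mul, RingHom.id_apply, Finset.mul_sum]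
    exact Finset.sum_congr rfl fun F _ => by ring

/-- The defining property of the adjoint, `(δ f, g) = (f, δ^* g)`. -/
theorem scalar_coboundary (K : FaceComplex V) (w : Finset V → ℝ)
    (hw : ∀ F ∈ K.faces, 0 < w F) (i j : ℤ) (f : K.Cochain i) (g : K.Cochain j) :
    K.scalar w j (K.coboundary i j f) g = K.scalar w i f (K.coboundaryAdj w i j g) := by
  simp only [scalar, coboundary, coboundaryAdj, LinearMap.coe_mk, AddHom.coe_mk, Finset.mul_sum,
    Finset.sum_mul]
  rw [Finset.sum_comm]
  refine Finset.sum_congr rfl fun F _ => Finset.sum_congr rfl fun G _ => ?_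
  have h : w F.1 ≠ 0 := (hw F.1 (Finset.mem_filter.1 F.2).1).ne'
  field_simp

/-- The `i`-up Laplace operator `δ_i^* δ_i` on `C^i(K, ℝ)` for the weight function `w`. -/
def upLaplacian (K : FaceComplex V) (w : Finset V → ℝ) (i : ℤ) :
    K.Cochain i →ₗ[ℝ] K.Cochain i :=
  K.coboundaryAdj w i (i + 1) ∘ₗ K.coboundary i (i + 1)

/-- The `i`-down Laplace operator `δ_{i-1} δ_{i-1}^*` on `C^i(K, ℝ)` for the weight function
`w`. -/
def downLaplacian (K : FaceComplex V) (w : Finset V → ℝ) (i : ℤ) :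
    K.Cochain i →ₗ[ℝ] K.Cochain i :=
  K.coboundary (i - 1) i ∘ₗ K.coboundaryAdj w (i - 1) i

/-- The degree of a face: the sum of the weights of the faces that contain it in their boundary. -/
def deg (K : FaceComplex V) (w : Finset V → ℝ) (F : Finset V) : ℝ :=
  ∑ G ∈ K.faces.filter (fun G => F ⊆ G ∧ G.card = F.card + 1), w G

/-- A facet is a face that is maximal under inclusion. -/
def IsFacet (K : FaceComplex V) (F : Finset V) : Prop :=
  F ∈ K.faces ∧ ∀ G ∈ K.faces, F ⊆ G → G = F

/-- `w` is a positive weight function on the faces of `K` whose Laplace operator is the (weighted)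
normalized one: the weight of every face that is not a facet equals its degree. The weights of the
facets may be arbitrary positive numbers; the unweighted normalized Laplace operator is the case
in which they are all `1`. -/
def IsNormalizing (K : FaceComplex V) (w : Finset V → ℝ) : Prop :=
  (∀ F ∈ K.faces, 0 < w F) ∧ ∀ F ∈ K.faces, ¬ K.IsFacet F → w F = K.deg w F

end FaceComplex

/-- `F₁ * F₂ = F₁ ∪ (n + F₂)`, the second set of vertices being shifted by `n`. -/
def joinFace {n m : ℕ} (F₁ : Finset (Fin n)) (F₂ : Finset (Fin m)) : Finset (Fin (n + m)) :=
  F₁.image (Fin.castAdd m) ∪ F₂.image (Fin.natAdd n)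

/-- The part `F₁` of `F = F₁ * F₂`. -/
def leftPart {n m : ℕ} (F : Finset (Fin (n + m))) : Finset (Fin n) :=
  Finset.univ.filter fun v => Fin.castAdd m v ∈ F

/-- The part `F₂` of `F = F₁ * F₂`. -/
def rightPart {n m : ℕ} (F : Finset (Fin (n + m))) : Finset (Fin m) :=
  Finset.univ.filter fun u => Fin.natAdd n u ∈ F

theorem leftPart_joinFace {n m : ℕ} (F₁ : Finset (Fin n)) (F₂ : Finset (Fin m)) :
    leftPart (joinFace F₁ F₂) = F₁ := by
  ext v
  simp only [leftPart, joinFace, Finset.mem_filter, Finset.mem_univ, true_and, Finset.mem_union,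
    Finset.mem_image]
  constructor
  · rintro (⟨a, ha, h⟩ | ⟨a, ha, h⟩)
    · have : a = v := by
        apply Fin.ext
        simpa using congrArg Fin.val h
      exact this ▸ ha
    · exfalso
      have h' := congrArg Fin.val h
      simp at h'
      omega
  · exact fun h => Or.inl ⟨v, h, rfl⟩

theorem rightPart_joinFace {n m : ℕ} (F₁ : Finset (Fin n)) (F₂ : Finset (Fin m)) :
    rightPart (joinFace F₁ F₂) = F₂ := by
  ext u
  simp only [rightPart, joinFace, Finset.mem_filter, Finset.mem_univ, true_and, Finset.mem_union,
    Finset.mem_image]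
  constructor
  · rintro (⟨a, ha, h⟩ | ⟨a, ha, h⟩)
    · exfalso
      have h' := congrArg Fin.val h
      simp at h'
      omega
    · have : a = u := by
        apply Fin.ext
        simpa using congrArg Fin.val h
      exact this ▸ ha
  · exact fun h => Or.inr ⟨u, h, rfl⟩

theorem joinFace_parts {n m : ℕ} (F : Finset (Fin (n + m))) :
    joinFace (leftPart F) (rightPart F) = F := by
  ext x
  have hl : ∀ v : Fin n, v ∈ leftPart (joinFace (leftPart F) (rightPart F)) ↔ v ∈ leftPart F := by
    rw [leftPart_joinFace]
    exact fun _ => Iff.rfl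
  have hr : ∀ u : Fin m, u ∈ rightPart (joinFace (leftPart F) (rightPart F)) ↔
      u ∈ rightPart F := by
    rw [rightPart_joinFace]
    exact fun _ => Iff.rfl
  refine Fin.addCases (fun v => ?_) (fun u => ?_) x
  · exact (Finset.mem_filter.trans (and_iff_right (Finset.mem_univ v))).symm.trans
      ((hl v).trans (Finset.mem_filter.trans (and_iff_right (Finset.mem_univ v))))
  · exact (Finset.mem_filter.trans (and_iff_right (Finset.mem_univ u))).symm.trans
      ((hr u).trans (Finset.mem_filter.trans (and_iff_right (Finset.mem_univ u))))

/-- The join `K₁ * K₂` of complexes on the vertex sets `[n]` and `[m]`, a complex on `[n + m]`: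
its faces are the sets `F₁ * F₂` with `F₁ ∈ K₁` and `F₂ ∈ K₂`. -/
def FaceComplex.join {n m : ℕ} (K₁ : FaceComplex (Fin n)) (K₂ : FaceComplex (Fin m)) :
    FaceComplex (Fin (n + m)) where
  faces := Finset.image₂ joinFace K₁.faces K₂.faces
  empty_mem := Finset.mem_image₂.2 ⟨∅, K₁.empty_mem, ∅, K₂.empty_mem, by simp [joinFace]⟩
  down_closed := by
    intro F G hG hFG
    obtain ⟨G₁, h₁, G₂, h₂, rfl⟩ := Finset.mem_image₂.1 hG
    refine Finset.mem_image₂.2 ⟨leftPart F, K₁.down_closed h₁ ?_, rightPart F,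
      K₂.down_closed h₂ ?_, joinFace_parts F⟩
    · rw [← leftPart_joinFace G₁ G₂]
      intro v hv
      simp only [leftPart, Finset.mem_filter, Finset.mem_univ, true_and] at hv ⊢
      exact hFG hv
    · rw [← rightPart_joinFace G₁ G₂]
      intro v hv
      simp only [rightPart, Finset.mem_filter, Finset.mem_univ, true_and] at hv ⊢
      exact hFG hv

/-- The product weight function on a join: `w(F₁ * F₂) = w₁(F₁) w₂(F₂)`. -/
def joinWeight {n m : ℕ} (w₁ : Finset (Fin n) → ℝ) (w₂ : Finset (Fin m) → ℝ) :
    Finset (Fin (n + m)) → ℝ :=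
  fun F => w₁ (leftPart F) * w₂ (rightPart F)

theorem joinWeight_joinFace {n m : ℕ} (w₁ : Finset (Fin n) → ℝ) (w₂ : Finset (Fin m) → ℝ)
    (F₁ : Finset (Fin n)) (F₂ : Finset (Fin m)) :
    joinWeight w₁ w₂ (joinFace F₁ F₂) = w₁ F₁ * w₂ F₂ := by
  rw [joinWeight, leftPart_joinFace, rightPart_joinFace]

/-- The complex consisting of a single vertex (and the empty face). The cone `v * K` over `K` is
the join of this complex with `K`. -/
def FaceComplex.point : FaceComplex (Fin 1) where
  faces := Finset.univ
  empty_mem := Finset.mem_univ _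
  down_closed := fun _ _ => Finset.mem_univ _

/-- `s(A)`: the multiset of the eigenvalues of an operator on a finite-dimensional real vector
space, with multiplicities. (It is used for operators that are self-adjoint for some scalar
product, for which algebraic and geometric multiplicities agree and all eigenvalues are real.) -/
def spec {E : Type} [AddCommGroup E] [Module ℝ E] [Module.Finite ℝ E] [Module.Free ℝ E]
    (A : E →ₗ[ℝ] E) : Multiset ℝ :=
  A.charpoly.roots

/-- Two multisets differ at most in the multiplicity of zero. -/
def EqUpToZero (s t : Multiset ℝ) : Prop := s.filter (· ≠ 0) = t.filter (· ≠ 0)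

/-- The multiset of all sums `λ + μ` with `λ` in `s` and `μ` in `t`, with multiplicities. -/
def sumset (s t : Multiset ℝ) : Multiset ℝ := (s ×ˢ t).map fun p => p.1 + p.2

/-- The multiset that differs from `s` only in the multiplicity of zero and has exactly `N`
elements (if `s` has at most `N` nonzero elements). -/
def withZeros (s : Multiset ℝ) (N : ℕ) : Multiset ℝ :=
  s.filter (· ≠ 0) + Multiset.replicate (N - (s.filter (· ≠ 0)).card) 0

end

/-! A face of the join in degree `d₁ + d₂ + 1` is `F₁ * F₂` for a unique pair of top-dimensional
faces. In the basis of faces, the entry of the down Laplacian at two faces is a sum over their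
common codimension one faces. For `F₁ * F₂` and `G₁ * G₂` such a common face arises by deleting a
vertex on the same side of both, so the opposite parts agree; their weight cancels, and their sign
enters squared (`downCoeff_joinFace`). Hence the matrix is the Kronecker sum `M₁ ⊗ 1 + 1 ⊗ M₂`
(`downMatrix_join`). Each `Mᵢ` is similar to a symmetric matrix, hence diagonalizable, and the
eigenvalues of a Kronecker sum are the sums of eigenvalues.

The up formula follows because `δ^*δ` and `δδ^*` have the same nonzero spectrum. The cone is the
join with a point, whose top down spectrum is `{1}`. -/

/-- A real square matrix that has a basis of eigenvectors, with eigenvalues `e`. -/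
def DiagonalizesTo {ι : Type} [Fintype ι] [DecidableEq ι] (M : Matrix ι ι ℝ) (e : ι → ℝ) : Prop :=
  ∃ P Q : Matrix ι ι ℝ, Q * P = 1 ∧ P * Q = 1 ∧ M = P * Matrix.diagonal e * Q

/-! ### Diagonalizable matrices and Kronecker sums. -/

namespace DiagonalizesTo

open Matrix Polynomial Kronecker

variable {ι κ : Type} [Fintype ι] [DecidableEq ι] [Fintype κ] [DecidableEq κ]

theorem roots_charpoly {M : Matrix ι ι ℝ} {e : ι → ℝ} (h : DiagonalizesTo M e) :
    M.charpoly.roots = Finset.univ.val.map e := by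
  obtain ⟨P, Q, hQP, -, rfl⟩ := h
  rw [Matrix.mul_assoc, Matrix.charpoly_mul_comm, Matrix.mul_assoc, hQP, Matrix.mul_one,
    Matrix.charpoly_diagonal, Polynomial.roots_prod]
  · simp
  · simp [Finset.prod_ne_zero_iff, Polynomial.X_sub_C_ne_zero]

/-- If the columns of `P` and `R` are eigenbases, their pairwise tensor products are a common
eigenbasis of both summands. -/
theorem kroneckerSum {M : Matrix ι ι ℝ} {e : ι → ℝ} {N : Matrix κ κ ℝ} {f : κ → ℝ}
    (hM : DiagonalizesTo M e) (hN : DiagonalizesTo N f) :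
    DiagonalizesTo (M ⊗ₖ (1 : Matrix κ κ ℝ) + (1 : Matrix ι ι ℝ) ⊗ₖ N)
      (fun p => e p.1 + f p.2) := by
  obtain ⟨P, Q, h₁, h₂, rfl⟩ := hM
  obtain ⟨R, S, h₃, h₄, rfl⟩ := hN
  refine ⟨P ⊗ₖ R, Q ⊗ₖ S, ?_, ?_, ?_⟩
  · rw [← mul_kronecker_mul, h₁, h₃, one_kronecker_one]
  · rw [← mul_kronecker_mul, h₂, h₄, one_kronecker_one]
  · have : diagonal (fun p : ι × κ => e p.1 + f p.2) =
        diagonal e ⊗ₖ (1 : Matrix κ κ ℝ) + (1 : Matrix ι ι ℝ) ⊗ₖ diagonal f := by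
      rw [← diagonal_one, ← diagonal_one, diagonal_kronecker_diagonal,
        diagonal_kronecker_diagonal, diagonal_add]
      simp
    rw [this, Matrix.mul_add, Matrix.add_mul, ← mul_kronecker_mul, ← mul_kronecker_mul,
      ← mul_kronecker_mul, ← mul_kronecker_mul, Matrix.mul_one, Matrix.mul_one, h₂, h₄]

/-- The down Laplacian in matrix form: a product `B a Bᵀ c` with diagonal `a` and positive diagonal
`c` is similar to a symmetric matrix. -/
theorem of_weights (B : Matrix ι κ ℝ) (a : κ → ℝ) (c : ι → ℝ) (hc : ∀ i, 0 < c i) :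
    ∃ e, DiagonalizesTo (B * (diagonal a * Bᵀ * diagonal c)) e := by
  set D : Matrix ι ι ℝ := diagonal fun i => √(c i) with hD
  set D' : Matrix ι ι ℝ := diagonal fun i => (√(c i))⁻¹ with hD'
  have hs : ∀ i, √(c i) ≠ 0 := fun i => (Real.sqrt_pos.2 (hc i)).ne'
  have h₁ : D * D' = 1 := by simp [hD, hD', hs]
  have h₂ : D' * D = 1 := by simp [hD, hD', hs]
  have h₃ : diagonal c = D * D := by
    simp only [hD, diagonal_mul_diagonal]
    exact congrArg _ (funext fun i => (Real.mul_self_sqrt (hc i).le).symm)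
  have hS : (D * B * diagonal a * Bᵀ * D).IsHermitian := by
    rw [Matrix.IsHermitian, conjTranspose_eq_transpose_of_trivial]
    simp [hD, Matrix.transpose_mul, Matrix.mul_assoc]
  set U : Matrix ι ι ℝ := (hS.eigenvectorUnitary : Matrix ι ι ℝ) with hU
  have hU₁ : U * star U = 1 := Unitary.coe_mul_star_self hS.eigenvectorUnitary
  have hU₂ : star U * U = 1 := Unitary.coe_star_mul_self hS.eigenvectorUnitary
  have hsp : D * B * diagonal a * Bᵀ * D = U * diagonal hS.eigenvalues * star U := by
    conv_lhs => rw [hS.spectral_theorem, Unitary.conjStarAlgAut_apply]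
    rfl
  refine ⟨hS.eigenvalues, D' * U, star U * D, ?_, ?_, ?_⟩
  · rw [Matrix.mul_assoc, ← Matrix.mul_assoc D, h₁, Matrix.one_mul, hU₂]
  · rw [Matrix.mul_assoc, ← Matrix.mul_assoc U, hU₁, Matrix.one_mul, h₂]
  -- Since `D` is the square root of `diagonal c`, conjugation by `D` moves one of its two factors
  -- to the left and makes the product symmetric.
  · calc B * (diagonal a * Bᵀ * diagonal c)
        = (D' * D) * B * diagonal a * Bᵀ * (D * D) := by
          rw [h₂, h₃]; simp only [Matrix.mul_assoc, Matrix.one_mul]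
      _ = D' * (D * B * diagonal a * Bᵀ * D) * D := by simp only [Matrix.mul_assoc]
      _ = D' * (U * diagonal hS.eigenvalues * star U) * D :=
          congrArg (fun X => D' * X * D) hsp
      _ = _ := by simp only [Matrix.mul_assoc]

end DiagonalizesTo

/-! ### Spectra up to the multiplicity of zero. -/

/-- The two characteristic polynomials agree after multiplication by powers of `X`, which contribute
only zero roots. -/
theorem eqUpToZero_roots_charpoly_mul_comm {ι κ : Type} [Fintype ι] [DecidableEq ι] [Fintype κ]
    [DecidableEq κ] (A : Matrix ι κ ℝ) (B : Matrix κ ι ℝ) :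
    EqUpToZero (A * B).charpoly.roots (B * A).charpoly.roots := by
  have h := congrArg Polynomial.roots (Matrix.charpoly_mul_comm' A B)
  rw [Polynomial.roots_mul (mul_ne_zero (pow_ne_zero _ Polynomial.X_ne_zero)
      (Matrix.charpoly_monic _).ne_zero),
    Polynomial.roots_mul (mul_ne_zero (pow_ne_zero _ Polynomial.X_ne_zero)
      (Matrix.charpoly_monic _).ne_zero), Polynomial.roots_X_pow, Polynomial.roots_X_pow] at h
  have h' := congrArg (Multiset.filter (· ≠ 0)) h
  simpa [EqUpToZero, Multiset.filter_add, Multiset.filter_nsmul, Multiset.filter_singleton]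
    using h'

theorem EqUpToZero.withZeros_eq {s t : Multiset ℝ} (h : EqUpToZero s t) :
    withZeros s t.card = t := by
  have h₁ : t.filter (· ≠ 0) + t.filter (fun x => ¬ x ≠ 0) = t := Multiset.filter_add_not _ _
  have h₂ : t.filter (fun x => ¬ x ≠ 0) = Multiset.replicate (t.filter (fun x => ¬ x ≠ 0)).card 0 :=
    Multiset.eq_replicate_card.2 fun x hx => by simpa using (Multiset.mem_filter.1 hx).2
  have h₃ : t.card - (t.filter (· ≠ 0)).card = (t.filter (fun x => ¬ x ≠ 0)).card := by
    have := congrArg Multiset.card h₁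
    rw [Multiset.card_add] at this
    omega
  rw [EqUpToZero] at h
  rw [withZeros, h, h₃, ← h₂, h₁]

/-! ### Matrices of the Laplace operators. -/

namespace FaceComplex

open Matrix

variable {V : Type} [LinearOrder V] [Fintype V]

/-- The matrix of the coboundary map. -/
noncomputable def coboundaryMatrix (K : FaceComplex V) (i j : ℤ) : Matrix (K.iFaces j) (K.iFaces i) ℝ :=
  fun G F => bdrySign F.1 G.1

/-- The matrix of the adjoint of the coboundary map. -/
noncomputable def coboundaryAdjMatrix (K : FaceComplex V) (w : Finset V → ℝ) (i j : ℤ) :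
    Matrix (K.iFaces i) (K.iFaces j) ℝ :=
  fun F G => w G.1 / w F.1 * bdrySign F.1 G.1

theorem coboundary_eq_toLin' (K : FaceComplex V) (i j : ℤ) :
    K.coboundary i j = Matrix.toLin' (K.coboundaryMatrix i j) := rfl

theorem coboundaryAdj_eq_toLin' (K : FaceComplex V) (w : Finset V → ℝ) (i j : ℤ) :
    K.coboundaryAdj w i j = Matrix.toLin' (K.coboundaryAdjMatrix w i j) := rfl

theorem spec_upLaplacian (K : FaceComplex V) (w : Finset V → ℝ) (i : ℤ) :
    spec (K.upLaplacian w i) =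
      (K.coboundaryAdjMatrix w i (i + 1) * K.coboundaryMatrix i (i + 1)).charpoly.roots := by
  rw [spec, upLaplacian, coboundary_eq_toLin', coboundaryAdj_eq_toLin', ← Matrix.toLin'_mul,
    Matrix.charpoly_toLin']

/-- The matrix of the down Laplacian. -/
noncomputable def downMatrix (K : FaceComplex V) (w : Finset V → ℝ) (i : ℤ) :
    Matrix (K.iFaces i) (K.iFaces i) ℝ :=
  K.coboundaryMatrix (i - 1) i * K.coboundaryAdjMatrix w (i - 1) i

theorem spec_downLaplacian (K : FaceComplex V) (w : Finset V → ℝ) (i : ℤ) :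
    spec (K.downLaplacian w i) = (K.downMatrix w i).charpoly.roots := by
  rw [spec, downLaplacian, coboundary_eq_toLin', coboundaryAdj_eq_toLin', ← Matrix.toLin'_mul,
    Matrix.charpoly_toLin', downMatrix]

theorem spec_up_eqUpToZero_spec_down (K : FaceComplex V) (w : Finset V → ℝ) {i j : ℤ}
    (h : i + 1 = j) :
    EqUpToZero (spec (K.upLaplacian w i)) (spec (K.downLaplacian w j)) := by
  obtain rfl : i = j - 1 := by omega
  -- The degree `j - 1 + 1` occurs in the index types of the matrices, so it is generalized to `k`
  -- before being identified with `j`.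
  have key : ∀ k, k = j → EqUpToZero
      (K.coboundaryAdjMatrix w (j - 1) k * K.coboundaryMatrix (j - 1) k).charpoly.roots
      (K.downMatrix w j).charpoly.roots := by
    rintro k rfl
    exact eqUpToZero_roots_charpoly_mul_comm _ _
  rw [spec_upLaplacian, spec_downLaplacian]
  exact key _ h

theorem exists_diagonalizesTo_downMatrix (K : FaceComplex V) {w : Finset V → ℝ}
    (hw : ∀ F ∈ K.faces, 0 < w F) (i : ℤ) : ∃ e, DiagonalizesTo (K.downMatrix w i) e := by
  have h := DiagonalizesTo.of_weights (K.coboundaryMatrix (i - 1) i) (fun F => (w F.1)⁻¹)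
    (fun G => w G.1) fun G => hw G.1 (Finset.mem_filter.1 G.2).1
  have hA : K.coboundaryAdjMatrix w (i - 1) i = diagonal (fun F : K.iFaces (i - 1) => (w F.1)⁻¹) *
      (K.coboundaryMatrix (i - 1) i)ᵀ * diagonal (fun G : K.iFaces i => w G.1) := by
    ext F G
    simp only [coboundaryAdjMatrix, coboundaryMatrix, mul_diagonal, diagonal_mul, transpose_apply]
    ring
  rwa [downMatrix, hA]

/-- A real characteristic polynomial may have too few real roots; diagonalizability supplies the
full number. -/
theorem card_spec_downLaplacian (K : FaceComplex V) {w : Finset V → ℝ}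
    (hw : ∀ F ∈ K.faces, 0 < w F) (i : ℤ) :
    (spec (K.downLaplacian w i)).card = (K.iFaces i).card := by
  obtain ⟨e, he⟩ := K.exists_diagonalizesTo_downMatrix hw i
  rw [spec_downLaplacian, he.roots_charpoly, Multiset.card_map, Finset.card_val, Finset.card_univ, Fintype.card_coe]

/-- Knowing the number of eigenvalues upgrades equality up to zeros to equality; this reduces the up
formula to the down formula. -/
theorem withZeros_spec_upLaplacian (K : FaceComplex V) {w : Finset V → ℝ}
    (hw : ∀ F ∈ K.faces, 0 < w F) (i : ℤ) :
    withZeros (spec (K.upLaplacian w (i - 1))) (K.iFaces i).card = spec (K.downLaplacian w i) := by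
  rw [← K.card_spec_downLaplacian hw i]
  exact (K.spec_up_eqUpToZero_spec_down w (by omega)).withZeros_eq

/-- The coefficient of the down Laplacian at the faces `G` and `G'`, as a sum over their vertices. -/
noncomputable def downCoeff (w : Finset V → ℝ) (G G' : Finset V) : ℝ :=
  ∑ v ∈ G, ∑ v' ∈ G', if G.erase v = G'.erase v' then
    (-1 : ℝ) ^ (G.filter (· < v)).card * (-1 : ℝ) ^ (G'.filter (· < v')).card *
      (w G' / w (G.erase v)) else 0

theorem downMatrix_apply (K : FaceComplex V) (w : Finset V → ℝ) (i : ℤ) (G G' : K.iFaces i) :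
    K.downMatrix w i G G' = downCoeff w G.1 G'.1 := by
  -- A column of the matrix is the coboundary of a cochain, so `coboundary_apply` turns the sum over
  -- faces into one over the vertices of `G`; the result no longer involves `K`.
  have h : K.downMatrix w i G G' = K.coboundary (i - 1) i
      (fun F => w G'.1 / w F.1 * bdrySign F.1 G'.1) G := by
    rw [downMatrix, Matrix.mul_apply]
    rfl
  rw [h, K.coboundary_apply (by omega), downCoeff,
    ← Finset.sum_coe_sort G.1]
  refine Finset.sum_congr rfl fun v _ => ?_
  simp only [bdrySign, Finset.mul_sum]
  refine Finset.sum_congr rfl fun v' _ => ?_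
  by_cases hv : G.1.erase v.1 = G'.1.erase v'
  · rw [if_pos hv, if_pos hv.symm]
    ring
  · rw [if_neg hv, if_neg (Ne.symm hv)]
    ring

end FaceComplex

/-! ### Vertices, signs and coefficients of joined faces. -/

section joinFace

variable {n m : ℕ}

theorem castAdd_mem_joinFace {F₁ : Finset (Fin n)} {F₂ : Finset (Fin m)} {v : Fin n} :
    Fin.castAdd m v ∈ joinFace F₁ F₂ ↔ v ∈ F₁ := by
  conv_rhs => rw [← leftPart_joinFace F₁ F₂]
  simp [leftPart]

theorem natAdd_mem_joinFace {F₁ : Finset (Fin n)} {F₂ : Finset (Fin m)} {u : Fin m} :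
    Fin.natAdd n u ∈ joinFace F₁ F₂ ↔ u ∈ F₂ := by
  conv_rhs => rw [← rightPart_joinFace F₁ F₂]
  simp [rightPart]

theorem joinFace_inj {F₁ G₁ : Finset (Fin n)} {F₂ G₂ : Finset (Fin m)} :
    joinFace F₁ F₂ = joinFace G₁ G₂ ↔ F₁ = G₁ ∧ F₂ = G₂ := by
  refine ⟨fun h => ⟨?_, ?_⟩, fun h => by rw [h.1, h.2]⟩
  · rw [← leftPart_joinFace F₁ F₂, h, leftPart_joinFace]
  · rw [← rightPart_joinFace F₁ F₂, h, rightPart_joinFace]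

theorem Fin.castAdd_lt_natAdd (v : Fin n) (u : Fin m) : Fin.castAdd m v < Fin.natAdd n u := by
  rw [Fin.lt_def, Fin.val_castAdd, Fin.val_natAdd]
  omega

theorem Fin.castAdd_ne_natAdd (v : Fin n) (u : Fin m) : Fin.castAdd m v ≠ Fin.natAdd n u :=
  (Fin.castAdd_lt_natAdd v u).ne

theorem disjoint_image_castAdd_natAdd (F₁ : Finset (Fin n)) (F₂ : Finset (Fin m)) :
    Disjoint (F₁.image (Fin.castAdd m)) (F₂.image (Fin.natAdd n)) := by
  rw [Finset.disjoint_left]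
  intro x hx hx'
  obtain ⟨v, -, rfl⟩ := Finset.mem_image.1 hx
  obtain ⟨u, -, h⟩ := Finset.mem_image.1 hx'
  exact Fin.castAdd_ne_natAdd v u h.symm

theorem sum_joinFace (F₁ : Finset (Fin n)) (F₂ : Finset (Fin m)) {M : Type} [AddCommMonoid M]
    (f : Fin (n + m) → M) :
    ∑ x ∈ joinFace F₁ F₂, f x = ∑ v ∈ F₁, f (Fin.castAdd m v) + ∑ u ∈ F₂, f (Fin.natAdd n u) := by
  rw [joinFace, Finset.sum_union (disjoint_image_castAdd_natAdd F₁ F₂),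
    Finset.sum_image fun _ _ _ _ h => Fin.castAdd_injective n m h,
    Finset.sum_image fun _ _ _ _ h => Fin.natAdd_injective m n h]

theorem card_joinFace (F₁ : Finset (Fin n)) (F₂ : Finset (Fin m)) :
    (joinFace F₁ F₂).card = F₁.card + F₂.card := by
  simp only [Finset.card_eq_sum_ones, sum_joinFace]

theorem joinFace_erase_castAdd (F₁ : Finset (Fin n)) (F₂ : Finset (Fin m)) (v : Fin n) :
    (joinFace F₁ F₂).erase (Fin.castAdd m v) = joinFace (F₁.erase v) F₂ := by
  ext x
  refine Fin.addCases (fun a => ?_) (fun b => ?_) x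
  · simp [castAdd_mem_joinFace]
  · simp [natAdd_mem_joinFace, (Fin.castAdd_ne_natAdd v b).symm]

theorem joinFace_erase_natAdd (F₁ : Finset (Fin n)) (F₂ : Finset (Fin m)) (u : Fin m) :
    (joinFace F₁ F₂).erase (Fin.natAdd n u) = joinFace F₁ (F₂.erase u) := by
  ext x
  refine Fin.addCases (fun a => ?_) (fun b => ?_) x
  · simp [castAdd_mem_joinFace, Fin.castAdd_ne_natAdd a u]
  · simp [natAdd_mem_joinFace]

theorem card_joinFace_filter_lt_castAdd (F₁ : Finset (Fin n)) (F₂ : Finset (Fin m)) (v : Fin n) :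
    ((joinFace F₁ F₂).filter (· < Fin.castAdd m v)).card = (F₁.filter (· < v)).card := by
  rw [Finset.card_filter, Finset.card_filter, sum_joinFace]
  simp only [(Fin.strictMono_castAdd m).lt_iff_lt, (Fin.castAdd_lt_natAdd v _).not_gt, if_false,
    Finset.sum_const_zero, add_zero]

/-- Every left vertex precedes every right one, so all of `F₁` is counted; this is the source of the
sign `(-1)^|F₁|`. -/
theorem card_joinFace_filter_lt_natAdd (F₁ : Finset (Fin n)) (F₂ : Finset (Fin m)) (u : Fin m) :
    ((joinFace F₁ F₂).filter (· < Fin.natAdd n u)).card =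
      F₁.card + (F₂.filter (· < u)).card := by
  rw [Finset.card_filter, Finset.card_filter, sum_joinFace, Finset.card_eq_sum_ones]
  simp only [Fin.natAdd_lt_natAdd_iff, Fin.castAdd_lt_natAdd, if_true]

theorem downCoeff_joinFace (w₁ : Finset (Fin n) → ℝ) (w₂ : Finset (Fin m) → ℝ)
    {F₁ G₁ : Finset (Fin n)} {F₂ G₂ : Finset (Fin m)} (h₁ : F₁.card = G₁.card)
    (h₂ : F₂.card = G₂.card) (hw₁ : w₁ F₁ ≠ 0) (hw₂ : w₂ F₂ ≠ 0) :
    FaceComplex.downCoeff (joinWeight w₁ w₂) (joinFace F₁ F₂) (joinFace G₁ G₂) =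
      (if F₂ = G₂ then FaceComplex.downCoeff w₁ F₁ G₁ else 0) +
        if F₁ = G₁ then FaceComplex.downCoeff w₂ F₂ G₂ else 0 := by
  have hx₁ : ∀ v ∈ F₁, F₁.erase v ≠ G₁ := fun v hv h => by
    have := Finset.card_erase_add_one hv
    rw [h] at this
    omega
  have hx₂ : ∀ v ∈ G₁, F₁ ≠ G₁.erase v := fun v hv h => by
    have := Finset.card_erase_add_one hv
    rw [← h] at this
    omega
  simp only [FaceComplex.downCoeff, sum_joinFace, joinFace_erase_castAdd, joinFace_erase_natAdd,
    joinFace_inj, card_joinFace_filter_lt_castAdd, card_joinFace_filter_lt_natAdd,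
    joinWeight_joinFace, Finset.sum_add_distrib]
  -- The mixed terms delete a left vertex from one face and a right vertex from the other; the left
  -- parts would then have different cardinalities.
  have hc₁ : ∑ v ∈ F₁, ∑ u ∈ G₂, (if F₁.erase v = G₁ ∧ F₂ = G₂.erase u then
      (-1 : ℝ) ^ (F₁.filter (· < v)).card * (-1 : ℝ) ^ (G₁.card + (G₂.filter (· < u)).card) *
        (w₁ G₁ * w₂ G₂ / (w₁ (F₁.erase v) * w₂ F₂)) else 0) = 0 :=
    Finset.sum_eq_zero fun v hv => Finset.sum_eq_zero fun u _ =>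
      if_neg fun h => hx₁ v hv h.1
  have hc₂ : ∑ u ∈ F₂, ∑ v ∈ G₁, (if F₁ = G₁.erase v ∧ F₂.erase u = G₂ then
      (-1 : ℝ) ^ (F₁.card + (F₂.filter (· < u)).card) * (-1 : ℝ) ^ (G₁.filter (· < v)).card *
        (w₁ G₁ * w₂ G₂ / (w₁ F₁ * w₂ (F₂.erase u))) else 0) = 0 :=
    Finset.sum_eq_zero fun u _ => Finset.sum_eq_zero fun v hv =>
      if_neg fun h => hx₂ v hv h.1
  rw [hc₁, hc₂, add_zero, zero_add]
  congr 1
  · by_cases h : F₂ = G₂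
    · subst h
      rw [if_pos rfl]
      refine Finset.sum_congr rfl fun v _ => Finset.sum_congr rfl fun v' _ => ?_
      simp only [and_true, mul_div_mul_right _ _ hw₂]
    · simp [h]
  · by_cases h : F₁ = G₁
    · subst h
      rw [if_pos rfl]
      refine Finset.sum_congr rfl fun u _ => Finset.sum_congr rfl fun u' _ => ?_
      simp only [true_and, mul_div_mul_left _ _ hw₁, pow_add]
      -- Both deletions on the right pass the same left part, so its sign appears twice.
      have hsq : (-1 : ℝ) ^ F₁.card * (-1 : ℝ) ^ F₁.card = 1 := by
        rw [← mul_pow]; norm_num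
      split_ifs
      · linear_combination ((-1 : ℝ) ^ (F₂.filter (· < u)).card *
          (-1 : ℝ) ^ (G₂.filter (· < u')).card * (w₂ G₂ / w₂ (F₂.erase u))) * hsq
      · rfl
    · simp [h]

end joinFace

/-! ### The top down Laplacian of a join. -/

namespace FaceComplex

open Matrix Kronecker

variable {n m : ℕ} (K₁ : FaceComplex (Fin n)) (K₂ : FaceComplex (Fin m))

theorem card_le_dim_add_one {V : Type} [LinearOrder V] [Fintype V] (K : FaceComplex V)
    {F : Finset V} (hF : F ∈ K.faces) : (F.card : ℤ) ≤ K.dim + 1 := by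
  have : F.card ≤ K.faces.sup Finset.card := Finset.le_sup hF
  rw [dim]
  omega

theorem joinFace_mem_iFaces {i j : ℤ} (F₁ : K₁.iFaces i) (F₂ : K₂.iFaces j) :
    joinFace F₁.1 F₂.1 ∈ (K₁.join K₂).iFaces (i + j + 1) := by
  obtain ⟨h₁, h₁'⟩ := Finset.mem_filter.1 F₁.2
  obtain ⟨h₂, h₂'⟩ := Finset.mem_filter.1 F₂.2
  refine Finset.mem_filter.2 ⟨Finset.mem_image₂.2 ⟨_, h₁, _, h₂, rfl⟩, ?_⟩
  rw [card_joinFace]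
  push_cast
  omega

/-- The top-dimensional faces of a join are the joins of the top-dimensional faces. -/
noncomputable def topFacesJoinEquiv :
    K₁.iFaces K₁.dim × K₂.iFaces K₂.dim ≃ (K₁.join K₂).iFaces (K₁.dim + K₂.dim + 1) :=
  Equiv.ofBijective (fun p => ⟨joinFace p.1.1 p.2.1, K₁.joinFace_mem_iFaces K₂ p.1 p.2⟩) <| by
    constructor
    · intro p q h
      have h' := joinFace_inj.1 (congrArg Subtype.val h)
      exact Prod.ext (Subtype.ext h'.1) (Subtype.ext h'.2)
    · rintro ⟨F, hF⟩
      obtain ⟨hF₁, hF₂⟩ := Finset.mem_filter.1 hF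
      obtain ⟨G₁, h₁, G₂, h₂, rfl⟩ := Finset.mem_image₂.1 hF₁
      have hd₁ := K₁.card_le_dim_add_one h₁
      -- The cardinalities are bounded by `K₁.dim + 1` and `K₂.dim + 1` and add up to the sum of
      -- these bounds, so both bounds are attained.
      have hd₂ := K₂.card_le_dim_add_one h₂
      rw [card_joinFace] at hF₂
      push_cast at hF₂
      exact ⟨(⟨G₁, Finset.mem_filter.2 ⟨h₁, by omega⟩⟩, ⟨G₂, Finset.mem_filter.2 ⟨h₂, by omega⟩⟩),
        rfl⟩

/-- The conditions `F₂ = G₂` and `F₁ = G₁` in `downCoeff_joinFace` are the entries of the identity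
factors. -/
theorem downMatrix_join {w₁ : Finset (Fin n) → ℝ} {w₂ : Finset (Fin m) → ℝ}
    (hw₁ : ∀ F ∈ K₁.faces, 0 < w₁ F) (hw₂ : ∀ F ∈ K₂.faces, 0 < w₂ F) :
    (K₁.join K₂).downMatrix (joinWeight w₁ w₂) (K₁.dim + K₂.dim + 1) =
      reindex (K₁.topFacesJoinEquiv K₂) (K₁.topFacesJoinEquiv K₂)
        (K₁.downMatrix w₁ K₁.dim ⊗ₖ (1 : Matrix (K₂.iFaces K₂.dim) (K₂.iFaces K₂.dim) ℝ) +
          (1 : Matrix (K₁.iFaces K₁.dim) (K₁.iFaces K₁.dim) ℝ) ⊗ₖ K₂.downMatrix w₂ K₂.dim) := by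
  refine (Equiv.symm_apply_eq (reindex _ _)).1 ?_
  ext ⟨F₁, F₂⟩ ⟨G₁, G₂⟩
  have hF₁ := Finset.mem_filter.1 F₁.2
  have hF₂ := Finset.mem_filter.1 F₂.2
  have hG₁ := Finset.mem_filter.1 G₁.2
  have hG₂ := Finset.mem_filter.1 G₂.2
  rw [reindex_symm, reindex_apply, submatrix_apply, downMatrix_apply]
  change downCoeff _ (joinFace F₁.1 F₂.1) (joinFace G₁.1 G₂.1) = _
  rw [downCoeff_joinFace w₁ w₂ (by omega) (by omega) (hw₁ _ hF₁.1).ne' (hw₂ _ hF₂.1).ne',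
    Matrix.add_apply, kronecker_apply, kronecker_apply, downMatrix_apply, downMatrix_apply,
    Matrix.one_apply, Matrix.one_apply]
  simp only [Subtype.ext_iff, mul_ite, mul_one, mul_zero, ite_mul, one_mul, zero_mul]

/-- For the down operators the multisets agree including zeros, as the Kronecker sum determines the
whole spectrum. -/
theorem spec_downLaplacian_join {w₁ : Finset (Fin n) → ℝ} {w₂ : Finset (Fin m) → ℝ}
    (hw₁ : ∀ F ∈ K₁.faces, 0 < w₁ F) (hw₂ : ∀ F ∈ K₂.faces, 0 < w₂ F) :
    spec ((K₁.join K₂).downLaplacian (joinWeight w₁ w₂) (K₁.dim + K₂.dim + 1)) =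
      sumset (spec (K₁.downLaplacian w₁ K₁.dim)) (spec (K₂.downLaplacian w₂ K₂.dim)) := by
  obtain ⟨e₁, he₁⟩ := K₁.exists_diagonalizesTo_downMatrix hw₁ K₁.dim
  obtain ⟨e₂, he₂⟩ := K₂.exists_diagonalizesTo_downMatrix hw₂ K₂.dim
  rw [spec_downLaplacian, spec_downLaplacian, spec_downLaplacian, downMatrix_join K₁ K₂ hw₁ hw₂,
    charpoly_reindex, (he₁.kroneckerSum he₂).roots_charpoly, he₁.roots_charpoly,
    he₂.roots_charpoly, sumset, ← Finset.univ_product_univ, Finset.product_val]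
  change Multiset.map _ (Multiset.bind _ _) = Multiset.map _ (Multiset.bind _ _)
  simp only [Multiset.map_bind, Multiset.bind_map, Multiset.map_map, Function.comp_def]

/-! ### The one-vertex complex and the cone. -/

theorem dim_point : point.dim = 0 := by
  rw [dim, show point.faces.sup Finset.card = 1 by decide]
  rfl

theorem IsNormalizing.pos {V : Type} [LinearOrder V] [Fintype V] {K : FaceComplex V}
    {w : Finset V → ℝ} (h : K.IsNormalizing w) : ∀ F ∈ K.faces, 0 < w F := h.1

theorem spec_downLaplacian_point {w : Finset (Fin 1) → ℝ} (hw : point.IsNormalizing w) :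
    spec (point.downLaplacian w 0) = {1} := by
  have hdeg : point.deg w ∅ = w {0} := by
    rw [deg, show point.faces.filter (fun G => ∅ ⊆ G ∧ G.card = (∅ : Finset (Fin 1)).card + 1) =
      {{0}} by decide, Finset.sum_singleton]
  -- The empty face is not a facet, so normalization applies to it; the single matrix entry `w {0} /
  -- w ∅` is therefore `1`.
  have hw₀ : w ∅ = w {0} := by
    rw [← hdeg]
    refine hw.2 ∅ point.empty_mem fun h => ?_
    exact Finset.singleton_ne_empty _ (h.2 {0} (Finset.mem_univ _) (Finset.empty_subset _))
  have hM : point.downMatrix w 0 = diagonal fun _ => 1 := by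
    have hG : ∀ G : point.iFaces 0, G.1 = {0} := by decide
    ext G G'
    have hGG' : G = G' := Subtype.ext ((hG G).trans (hG G').symm)
    rw [downMatrix_apply, ← hGG', diagonal_apply_eq, hG G, downCoeff]
    simp [Finset.filter_singleton, hw₀, (hw.1 {0} (Finset.mem_univ _)).ne']
  have hd : DiagonalizesTo (point.downMatrix w 0) fun _ => 1 :=
    ⟨1, 1, by simp, by simp, by simp [hM]⟩
  rw [spec_downLaplacian, hd.roots_charpoly, Multiset.map_const', Finset.card_val,
    Finset.card_univ, Fintype.card_coe, show (point.iFaces 0).card = 1 by decide]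
  rfl

theorem sumset_singleton (a : ℝ) (t : Multiset ℝ) : sumset {a} t = t.map fun b => a + b := by
  rw [sumset, ← Multiset.cons_zero, Multiset.cons_product, Multiset.zero_product, add_zero,
    Multiset.map_map]
  rfl

theorem spec_laplacians_join {d₁ d₂ : ℤ} (hd₁ : K₁.dim = d₁) (hd₂ : K₂.dim = d₂)
    {w₁ : Finset (Fin n) → ℝ} {w₂ : Finset (Fin m) → ℝ}
    (hw₁ : ∀ F ∈ K₁.faces, 0 < w₁ F) (hw₂ : ∀ F ∈ K₂.faces, 0 < w₂ F) :
    EqUpToZero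
      (spec ((K₁.join K₂).downLaplacian (joinWeight w₁ w₂) (d₁ + d₂ + 1)))
      (sumset (spec (K₁.downLaplacian w₁ d₁)) (spec (K₂.downLaplacian w₂ d₂))) ∧
    EqUpToZero
      (spec ((K₁.join K₂).upLaplacian (joinWeight w₁ w₂) (d₁ + d₂)))
      (sumset (spec (K₁.downLaplacian w₁ d₁)) (spec (K₂.downLaplacian w₂ d₂))) := by
  subst hd₁ hd₂
  rw [← spec_downLaplacian_join K₁ K₂ hw₁ hw₂]
  exact ⟨rfl, spec_up_eqUpToZero_spec_down _ _ rfl⟩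

end FaceComplex

theorem corollary6p7 (n m : ℕ) (K₁ : FaceComplex (Fin n)) (K₂ : FaceComplex (Fin m))
    (d₁ d₂ : ℤ) (hd₁ : K₁.dim = d₁) (hd₂ : K₂.dim = d₂)
    (w₁ : Finset (Fin n) → ℝ) (w₂ : Finset (Fin m) → ℝ)
    (hw₁ : K₁.IsNormalizing w₁) (hw₂ : K₂.IsNormalizing w₂) :
    -- the join formula for the top down Laplace operators
    EqUpToZero
      (spec ((K₁.join K₂).downLaplacian (joinWeight w₁ w₂) (d₁ + d₂ + 1)))
      (sumset (spec (K₁.downLaplacian w₁ d₁)) (spec (K₂.downLaplacian w₂ d₂))) ∧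
    -- its form for up Laplace operators, the zeros of the spectra of the factors being counted
    -- so that there are as many eigenvalues as top-dimensional faces
    EqUpToZero
      (spec ((K₁.join K₂).upLaplacian (joinWeight w₁ w₂) (d₁ + d₂)))
      (sumset
        (withZeros (spec (K₁.upLaplacian w₁ (d₁ - 1))) (K₁.iFaces d₁).card)
        (withZeros (spec (K₂.upLaplacian w₂ (d₂ - 1))) (K₂.iFaces d₂).card)) ∧
    -- both forms for the cone over `K₂`
    (∀ w₀ : Finset (Fin 1) → ℝ, FaceComplex.point.IsNormalizing w₀ →
      EqUpToZero
        (spec ((FaceComplex.point.join K₂).downLaplacian (joinWeight w₀ w₂) (d₂ + 1)))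
        ((spec (K₂.downLaplacian w₂ d₂)).map fun μ => 1 + μ) ∧
      EqUpToZero
        (spec ((FaceComplex.point.join K₂).upLaplacian (joinWeight w₀ w₂) d₂))
        ((withZeros (spec (K₂.upLaplacian w₂ (d₂ - 1))) (K₂.iFaces d₂).card).map
          fun μ => 1 + μ)) := by

  -- The padded up spectra, including the one in the cone formula, become down spectra, so all
  -- claims are about the same multisets.
  rw [K₁.withZeros_spec_upLaplacian hw₁.pos, K₂.withZeros_spec_upLaplacian hw₂.pos]
  obtain ⟨hdown, hup⟩ := K₁.spec_laplacians_join K₂ hd₁ hd₂ hw₁.pos hw₂.pos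
  refine ⟨hdown, hup, fun w₀ hw₀ => ?_⟩
  have h := FaceComplex.point.spec_laplacians_join K₂ FaceComplex.dim_point hd₂ hw₀.pos hw₂.pos
  rwa [zero_add, FaceComplex.spec_downLaplacian_point hw₀, FaceComplex.sumset_singleton] at h
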